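/- Let $N\ge 1$ and $d\ge 2$, and put $n=N(d-1)$. For a tuple $\mathbf k=(k_0,\dots,k_{d-1})$ of nonnegative integers with $\sum_a k_a=N$ let $|S^N_{\mathbf k}\rangle=\binom{N}{\mathbf k}^{-1/2}\sum_\pi \pi\big(\bigotimes_{a=0}^{d-1}|a\rangle^{\otimes k_a}\big)\in(\mathbb C^d)^{\otimes N}$, the sum being over the distinct permutations of the tensor factors. For $0\le k\le n$ let $$|D^N_k\rangle=\mathcal N_k^{-1/2}\sum_{\mathbf k:\ \sum_a k_a=N,\ \sum_a a\,k_a=k}\binom{N}{\mathbf k}^{1/2}|S^N_{\mathbf k}\rangle ,$$ where $\mathcal N_k$ is the squared norm of the sum, so that $|D^N_k\rangle$ is a unit vector. Let $\mathbb 1_{\mathcal D}=\sum_{k=0}^{n}|D^N_k\rangle\langle D^N_k|$, and for $\alpha\in\mathbb R$ and every operator $\rho$ on $(\mathbb C^d)^{\otimes N}$ let $\Lambda_\alpha(\rho)=\mathrm{Tr}(\rho)\,\mathbb 1_{\mathcal D}+\alpha\rho$. For a real sequence $(q_k)_{k=0}^{n}$ and $l\in\{0,1\}$ let $$M_l(\{q_k\})=\Big(\frac{q_{i+j+l}}{\mathcal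 N_{i+j+l}}\Big)_{0\le i,j\le n_l},\qquad n_l=\Big\lfloor \frac{n-l}{2}\Big\rfloor .$$ An operator on $(\mathbb C^d)^{\otimes N}$ (not necessarily of trace one) is called separable if it is a finite sum $\sum_j w_j|\Psi_j\rangle\langle\Psi_j|$ with $w_j\ge 0$ and each $\Psi_j=e_{j,1}\otimes\cdots\otimes e_{j,N}$ a product of unit vectors of $\mathbb C^d$. (1) Let $\rho_{DD}=\sum_{k=0}^{n}p_k|D^N_k\rangle\langle D^N_k|$ with $p_k\ge 0$ and $\sum_k p_k=1$. If $M_0(\{1+\alpha p_k\})$ and $M_1(\{1+\alpha p_k\})$ are positive semidefinite, then $\sigma_{DD}=\Lambda_\alpha(\rho_{DD})=\mathbb 1_{\mathcal D}+\alpha\rho_{DD}$ is separable. (2) Let $\alpha\ne 0$ and $\alpha\neq-(n+1)$. Then $\Lambda_\alpha$ is invertible, with inverse $\Lambda_\alpha^{-1}(\sigma)=\frac1\alpha\Big[\sigma-\frac{\mathrm{Tr}(\sigma)}{n+1+\alpha}\mathbb 1_{\mathcal D}\Big]$. Let $\sigma_{DD}=\sum_{k=0}^{n}s_k|D^N_k\rangle\langle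 D^N_k|$, with real $s_k$, satisfy $\sigma_{DD}\ge 0$ and $\rho:=\Lambda_\alpha^{-1}(\sigma_{DD})\ge 0$. Then $\sigma_{DD}$ is separable in each of the following two cases. (a) $\rho=\mathrm{Tr}(\rho)\sum_k p_k|D^N_k\rangle\langle D^N_k|$ for some $p_k\ge0$ with $\sum_kp_k=1$ for which $M_0(\{1+\alpha p_k\})$ and $M_1(\{1+\alpha p_k\})$ are positive semidefinite. (b) $\alpha$ is such that $M_0(\{1+\alpha p_k\})$ and $M_1(\{1+\alpha p_k\})$ are positive semidefinite for all $p_k\ge 0$ with $\sum_k p_k=1$. -/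

import Mathlib

open scoped ComplexOrder

namespace QuditDicke

noncomputable section

/-- Words `w = (w₁, …, w_N)` over `{0, …, d-1}`: they label the computational product basis
`|w₁⟩ ⊗ ⋯ ⊗ |w_N⟩` of `(ℂ^d)^{⊗N}`. -/
abbrev Word (N d : ℕ) : Type := Fin N → Fin d

/-- Vectors of `(ℂ^d)^{⊗N}`, in coordinates with respect to the computational basis. -/
abbrev Vec (N d : ℕ) : Type := Word N d → ℂ

/-- Operators on `(ℂ^d)^{⊗N}`, as matrices with respect to the computational basis. -/
abbrev Op (N d : ℕ) : Type := Matrix (Word N d) (Word N d) ℂ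

/-- The product vector `e₁ ⊗ ⋯ ⊗ e_N`. -/
def productVec {N d : ℕ} (e : Fin N → Fin d → ℂ) : Vec N d := fun w => ∏ i, e i (w i)

/-- The operator `|v⟩⟨v|`. -/
def ketbra {N d : ℕ} (v : Vec N d) : Op N d := Matrix.vecMulVec v (star v)

/-- Full separability of a (not necessarily normalized) operator: it is a finite combination with
nonnegative weights of projectors onto product vectors whose factors are unit vectors. The weights
sum to the trace, so for an operator of trace one this is a convex combination. -/
def IsSeparable {N d : ℕ} (σ : Op N d) : Prop :=
  ∃ (K : ℕ) (q : Fin K → ℝ) (e : Fin K → Fin N → Fin d → ℂ),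
    (∀ j, 0 ≤ q j) ∧ (∀ j i, ∑ a, ‖e j i a‖ ^ 2 = 1) ∧
      σ = ∑ j, (q j : ℂ) • ketbra (productVec (e j))

/-- The number of letters of the word `w` that are equal to `a`. -/
def occupation {N d : ℕ} (w : Word N d) : Fin d → ℕ :=
  fun a => (Finset.univ.filter fun i => w i = a).card

/-- The symmetric basis vector `|S_κ^N⟩` with occupation numbers `κ = (κ₀, …, κ_{d-1})`: the
multinomial coefficient to the power `-1/2` times the sum of the distinct permutations of
`⨂_a |a⟩^{⊗ κ_a}`, that is, of all basis vectors `|w⟩` with occupation numbers `κ`. -/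
def symVec (N d : ℕ) (κ : Fin d → ℕ) : Vec N d := fun w =>
  if occupation w = κ then ((Real.sqrt (Nat.multinomial Finset.univ κ))⁻¹ : ℝ) else 0

/-- The unnormalized Dicke vector `∑_κ (N choose κ)^{1/2} |S_κ^N⟩`, the sum being over all `κ` with
`κ₀ + ⋯ + κ_{d-1} = N` and `0 κ₀ + 1 κ₁ + ⋯ + (d-1) κ_{d-1} = k`. -/
def dickeSum (N d k : ℕ) : Vec N d :=
  ∑ κ ∈ (Finset.piAntidiag (Finset.univ : Finset (Fin d)) N).filter
      (fun κ => ∑ a : Fin d, (a : ℕ) * κ a = k),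
    ((Real.sqrt (Nat.multinomial Finset.univ κ) : ℝ) : ℂ) • symVec N d κ

/-- `𝒩_k`, the squared norm of the unnormalized Dicke vector. -/
def dickeNorm (N d k : ℕ) : ℝ := ∑ w, ‖dickeSum N d k w‖ ^ 2

/-- The generalized Dicke vector `|D_k^N⟩ = 𝒩_k^{-1/2} ∑_κ (N choose κ)^{1/2} |S_κ^N⟩`. -/
def dicke (N d k : ℕ) : Vec N d :=
  (((Real.sqrt (dickeNorm N d k))⁻¹ : ℝ) : ℂ) • dickeSum N d k

/-- The Dicke-diagonal operator `∑_{k=0}^{N(d-1)} p_k |D_k^N⟩⟨D_k^N|`. -/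
def dickeDiag (N d : ℕ) (p : Fin (N * (d - 1) + 1) → ℝ) : Op N d :=
  ∑ k, (p k : ℂ) • ketbra (dicke N d k)

/-- `𝟙_𝒟 = ∑_k |D_k^N⟩⟨D_k^N|`, the projector onto the span of the Dicke vectors. -/
def dickeProj (N d : ℕ) : Op N d :=
  ∑ k : Fin (N * (d - 1) + 1), ketbra (dicke N d k)

/-- The map `Λ_α(ρ) = Tr(ρ) 𝟙_𝒟 + α ρ`. -/
def reductionMap (N d : ℕ) (α : ℝ) (ρ : Op N d) : Op N d :=
  ρ.trace • dickeProj N d + (α : ℂ) • ρ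

/-- The inverse map `Λ_α⁻¹(σ) = α⁻¹ [σ - Tr(σ) 𝟙_𝒟 / (D + α)]`, where `D = N(d-1) + 1` is the
number of Dicke vectors; meaningful for `α ≠ 0` and `D + α ≠ 0`. -/
def reductionInv (N d : ℕ) (α : ℝ) (σ : Op N d) : Op N d :=
  (α : ℂ)⁻¹ • (σ - (σ.trace / (((N * (d - 1) + 1 : ℕ) : ℂ) + (α : ℂ))) • dickeProj N d)

/-- The Hankel matrix `M_l({q_k}) = (q_{i+j+l} / 𝒩_{i+j+l})_{0 ≤ i, j ≤ n_l}` for `l ∈ {0, 1}`, where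
`n_l = ⌊(N(d-1) - l) / 2⌋`. Its size `n_l + 1` is written `⌊(N(d-1) + 2 - l) / 2⌋`. -/
def hankel (N d : ℕ) (l : Fin 2) (q : Fin (N * (d - 1) + 1) → ℝ) :
    Matrix (Fin ((N * (d - 1) + 2 - (l : ℕ)) / 2)) (Fin ((N * (d - 1) + 2 - (l : ℕ)) / 2)) ℝ :=
  Matrix.of fun i j =>
    q ⟨(i : ℕ) + (j : ℕ) + (l : ℕ), by
        have hi := i.isLt
        have hj := j.isLt
        have hl := l.isLt
        omega⟩ / dickeNorm N d ((i : ℕ) + (j : ℕ) + (l : ℕ))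

/-- The matrices `M'_l = M_l({1 + α p_k})`, `l = 0, 1`, are both positive semidefinite. -/
def HankelPSD (N d : ℕ) (α : ℝ) (p : Fin (N * (d - 1) + 1) → ℝ) : Prop :=
  (hankel N d 0 fun k => 1 + α * p k).PosSemidef ∧
    (hankel N d 1 fun k => 1 + α * p k).PosSemidef

end

end QuditDicke

/-!
Write `n = N(d-1)`. In the computational basis the square roots of multinomial coefficients in the
Dicke vectors cancel (`dickeSum_apply`): `|D_k⟩` is the normalized sum of all basis words whose
letters add up to `k`. Hence `∑ q_k |D_k⟩⟨D_k|` has the entry `m_k = q_k / 𝒩_k` at every pair of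
words of letter sum `k`, and all other entries vanish (`dickeDiag_eq_momentOp`).

If `m_k = s^k (1-s)^(n-k)` with `0 ≤ s ≤ 1`, this operator is an average over phases of projectors
onto symmetric product vectors (`isSeparable_momentOp_momentCurve`), so it is separable. It remains
to see that positive semidefiniteness of the two Hankel matrices of `m` puts `m` into the cone over
this curve. That is the truncated moment problem on `[0, ∞]`
(`exists_smul_mem_convexHull_momentCurve`): the convex hull of the curve is compact, so a sequence
outside the cone would be separated from it by a linear functional, that is, by a polynomial of
degree at most `n` that is nonnegative on `[0, ∞)`. Such a polynomial is a sum of terms `f²` and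
`X g²` of degree at most `n` (`mem_halfLineCone_of_nonneg`), and on these terms the Hankel matrices
say that the Riesz functional of `m` is nonnegative, a contradiction.

Thus a Dicke-diagonal operator with positive semidefinite Hankel matrices is separable
(`isSeparable_dickeDiag_of_hankel_posSemidef`). The reduction map sends the Dicke-diagonal state
with coefficients `p_k` to the Dicke-diagonal operator with coefficients `1 + α p_k`, and the
statements about its inverse follow since it is linear and `Tr 𝟙_𝒟 = n + 1`.
-/

open scoped ComplexOrder

namespace QuditDicke

section MomentProblem

open Polynomial

/-! ### Nonnegative polynomials on the half-line -/

/-- The cone generated by the polynomials `f²` and `X g²` of degree at most `m`, the degree bound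
being imposed on every generator. -/
noncomputable def halfLineCone (m : ℕ) : AddSubmonoid ℝ[X] :=
  AddSubmonoid.closure
    ({p | ∃ f : ℝ[X], 2 * f.natDegree ≤ m ∧ p = f * f} ∪
      {p | ∃ g : ℝ[X], 2 * g.natDegree + 1 ≤ m ∧ p = X * (g * g)})

lemma sq_mem_halfLineCone {m : ℕ} {f : ℝ[X]} (hf : 2 * f.natDegree ≤ m) :
    f * f ∈ halfLineCone m :=
  AddSubmonoid.subset_closure (Or.inl ⟨f, hf, rfl⟩)

lemma X_mul_sq_mem_halfLineCone {m : ℕ} {g : ℝ[X]} (hg : 2 * g.natDegree + 1 ≤ m) :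
    X * (g * g) ∈ halfLineCone m :=
  AddSubmonoid.subset_closure (Or.inr ⟨g, hg, rfl⟩)

lemma C_mem_halfLineCone {m : ℕ} {c : ℝ} (hc : 0 ≤ c) : C c ∈ halfLineCone m := by
  have h := sq_mem_halfLineCone (m := m) (f := C √c) (by simp)
  rwa [← C_mul, Real.mul_self_sqrt hc] at h

lemma X_mem_halfLineCone : (X : ℝ[X]) ∈ halfLineCone 1 := by
  simpa using X_mul_sq_mem_halfLineCone (m := 1) (g := 1) (by simp)

lemma mul_mem_halfLineCone {a b : ℕ} {p q : ℝ[X]} (hp : p ∈ halfLineCone a)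
    (hq : q ∈ halfLineCone b) : p * q ∈ halfLineCone (a + b) := by
  induction hp using AddSubmonoid.closure_induction with
  | zero => simp
  | add x y _ _ hx hy => rw [add_mul]; exact add_mem hx hy
  | mem x hx =>
    induction hq using AddSubmonoid.closure_induction with
    | zero => simp
    | add u v _ _ hu hv => rw [mul_add]; exact add_mem hu hv
    | mem y hy =>
      rcases hx with ⟨f, hf, rfl⟩ | ⟨f, hf, rfl⟩ <;> rcases hy with ⟨g, hg, rfl⟩ | ⟨g, hg, rfl⟩
      · convert sq_mem_halfLineCone (m := a + b) (f := f * g) ?_ using 1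
        · ring
        · have := natDegree_mul_le (p := f) (q := g); omega
      · convert X_mul_sq_mem_halfLineCone (m := a + b) (g := f * g) ?_ using 1
        · ring
        · have := natDegree_mul_le (p := f) (q := g); omega
      · convert X_mul_sq_mem_halfLineCone (m := a + b) (g := f * g) ?_ using 1
        · ring
        · have := natDegree_mul_le (p := f) (q := g); omega
      · convert sq_mem_halfLineCone (m := a + b) (f := X * (f * g)) ?_ using 1
        · ring
        · have := natDegree_mul_le (p := f) (q := g)
          have := natDegree_mul_le (p := (X : ℝ[X])) (q := f * g)
          have := natDegree_X_le (R := ℝ)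
          omega

lemma pow_mem_halfLineCone {p : ℝ[X]} (hp : p ∈ halfLineCone 1) (m : ℕ) :
    p ^ m ∈ halfLineCone m := by
  induction m with
  | zero => simpa using C_mem_halfLineCone (m := 0) (zero_le_one' ℝ)
  | succ m ih => rw [pow_succ]; exact mul_mem_halfLineCone ih hp

lemma halfLineCone_mono {a b : ℕ} (h : a ≤ b) : halfLineCone a ≤ halfLineCone b := by
  refine AddSubmonoid.closure_mono ?_
  rintro p (⟨f, hf, rfl⟩ | ⟨f, hf, rfl⟩)
  · exact Or.inl ⟨f, hf.trans h, rfl⟩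
  · exact Or.inr ⟨f, hf.trans h, rfl⟩

/-- A polynomial that is nonnegative on the open half-line off a point is nonnegative on the closed
half-line. -/
lemma eval_nonneg_of_forall_ne {p : ℝ[X]} (z : ℝ)
    (h : ∀ t : ℝ, 0 < t → t ≠ z → 0 ≤ p.eval t) (t : ℝ) (ht : 0 ≤ t) : 0 ≤ p.eval t := by
  have hs : Set.Ioi (0 : ℝ) ∩ {z}ᶜ ⊆ {t | 0 ≤ p.eval t} := fun t ht => h t ht.1 ht.2
  have hc : IsClosed {t : ℝ | 0 ≤ p.eval t} := isClosed_le continuous_const p.continuous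
  have hd : Dense ({z}ᶜ : Set ℝ) := dense_compl_singleton z
  have h1 : Set.Ici (0 : ℝ) ⊆ closure (Set.Ioi (0 : ℝ) ∩ {z}ᶜ) := by
    rw [← closure_Ioi]
    exact closure_minimal (hd.open_subset_closure_inter isOpen_Ioi) isClosed_closure
  exact hc.closure_subset_iff.2 hs (h1 ht)

/-- A positive zero of a polynomial that is nonnegative on the half-line is a double zero. -/
lemma sq_dvd_of_isRoot_of_nonneg {p : ℝ[X]} (hp : ∀ t : ℝ, 0 ≤ t → 0 ≤ p.eval t) {z : ℝ}
    (hz : 0 < z) (hr : p.IsRoot z) : (X - C z) * (X - C z) ∣ p := by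
  obtain ⟨q, rfl⟩ := dvd_iff_isRoot.2 hr
  refine mul_dvd_mul_left _ (dvd_iff_isRoot.2 ?_)
  have hmin : IsLocalMin (fun t => ((X - C z) * q).eval t) z := by
    filter_upwards [lt_mem_nhds hz] with t ht
    rw [hr]
    exact hp t ht.le
  have := hmin.deriv_eq_zero
  rw [Polynomial.deriv] at this
  simpa [derivative_mul] using this

/-- A real polynomial of degree at most `m` that is nonnegative on `[0, ∞)` lies in the cone of `f²` and
`X g²`. One removes a complex root at a time: a root `z ≤ 0` gives the factor `X - z`, a positive
root the factor `(X - z)²`, and a nonreal root the factor `(X - Re z)² + (Im z)²`; all of them lie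
in the cone, which is closed under multiplication. -/
theorem mem_halfLineCone_of_nonneg (m : ℕ) (p : ℝ[X]) (hm : p.natDegree ≤ m)
    (hp : ∀ t : ℝ, 0 ≤ t → 0 ≤ p.eval t) : p ∈ halfLineCone m := by
  induction m using Nat.strong_induction_on generalizing p with
  | _ m ih =>
  -- the quotient `q` by a factor `r` of degree `k` is treated by induction
  have step : ∀ (r q : ℝ[X]) (k : ℕ) (z : ℝ), p = r * q → p ≠ 0 → r.natDegree = k → 0 < k →
      r ∈ halfLineCone k → (∀ t : ℝ, 0 < t → t ≠ z → 0 < r.eval t) → p ∈ halfLineCone m := by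
    intro r q k z hpq hp0 hrk hk hr hpos
    have hr0 : r ≠ 0 := by rintro rfl; simp at hpq; exact hp0 hpq
    have hq0 : q ≠ 0 := by rintro rfl; simp at hpq; exact hp0 hpq
    have hdeg : p.natDegree = k + q.natDegree := by rw [hpq, natDegree_mul hr0 hq0, hrk]
    have hq := ih (m - k) (by omega) q (by omega) <| eval_nonneg_of_forall_ne z fun t ht htz => by
      have h1 := hp t ht.le
      rw [hpq, eval_mul] at h1
      exact nonneg_of_mul_nonneg_right h1 (hpos t ht htz)
    have := mul_mem_halfLineCone hr hq
    rw [hpq]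
    exact halfLineCone_mono (by omega) this
  by_cases hd : p.natDegree = 0
  · rw [eq_C_of_natDegree_eq_zero hd]
    refine C_mem_halfLineCone ?_
    have := hp 0 le_rfl
    rwa [eq_C_of_natDegree_eq_zero hd, eval_C] at this
  have hp0 : p ≠ 0 := by rintro rfl; simp at hd
  obtain ⟨z, hz⟩ := IsAlgClosed.exists_aeval_eq_zero ℂ p
    (fun h => hd (natDegree_eq_of_degree_eq_some h))
  by_cases him : z.im = 0
  · have hzr : z = (z.re : ℂ) := Complex.ext rfl (by simp [him])
    have hroot : p.IsRoot z.re := by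
      have h1 : aeval ((algebraMap ℝ ℂ) z.re) p = 0 := by
        rw [show (algebraMap ℝ ℂ) z.re = z from hzr.symm, hz]
      rw [aeval_algebraMap_apply] at h1
      simpa using h1
    rcases le_or_gt z.re 0 with hneg | hpos
    · obtain ⟨q, hq⟩ := dvd_iff_isRoot.2 hroot
      refine step _ q 1 0 hq hp0 (natDegree_X_sub_C _) one_pos ?_ ?_
      · rw [sub_eq_add_neg, ← C_neg]
        exact add_mem X_mem_halfLineCone (C_mem_halfLineCone (by linarith))
      · intro t ht _
        simp only [eval_sub, eval_X, eval_C]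
        linarith
    · obtain ⟨q, hq⟩ := sq_dvd_of_isRoot_of_nonneg hp hpos hroot
      refine step _ q 2 z.re hq hp0 ?_ two_pos (sq_mem_halfLineCone ?_) ?_
      · rw [natDegree_mul (X_sub_C_ne_zero _) (X_sub_C_ne_zero _), natDegree_X_sub_C]
      · rw [natDegree_X_sub_C]
      · intro t _ htz
        simp only [eval_mul, eval_sub, eval_X, eval_C]
        exact mul_self_pos.2 (sub_ne_zero.2 htz)
  · obtain ⟨q, hq⟩ := p.quadratic_dvd_of_aeval_eq_zero_im_ne_zero hz him
    have hfac : (X ^ 2 - C (2 * z.re) * X + C (‖z‖ ^ 2) : ℝ[X]) =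
        (X - C z.re) * (X - C z.re) + C (z.im ^ 2) := by
      rw [Complex.sq_norm, Complex.normSq_apply]
      simp only [C_mul, C_add, C_pow, map_ofNat]
      ring
    rw [hfac] at hq
    refine step _ q 2 0 hq hp0 ?_ two_pos
      (add_mem (sq_mem_halfLineCone ?_) (C_mem_halfLineCone (sq_nonneg _))) ?_
    · rw [natDegree_add_C, natDegree_mul (X_sub_C_ne_zero _) (X_sub_C_ne_zero _),
        natDegree_X_sub_C]
    · rw [natDegree_X_sub_C]
    · intro t _ _
      simp only [eval_add, eval_mul, eval_sub, eval_X, eval_C]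
      have := mul_self_nonneg (t - z.re)
      positivity

/-! ### Compactness of convex hulls in finite dimension -/

/-- By Carathéodory's theorem the convex hull of a compact set in a finite-dimensional space is
a continuous image of a product of copies of the set with a simplex. -/
theorem _root_.IsCompact.convexHull_of_finiteDimensional {E : Type*} [NormedAddCommGroup E]
    [NormedSpace ℝ E] [FiniteDimensional ℝ E] {s : Set E} (hs : IsCompact s) :
    IsCompact (convexHull ℝ s) := by
  set D := Module.finrank ℝ E + 1 with hD
  let F : (Fin D → ℝ) × (Fin D → E) → E := fun x => ∑ i, x.1 i • x.2 i
  have hF : Continuous F := by fun_prop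
  have himg : convexHull ℝ s = F '' (stdSimplex ℝ (Fin D) ×ˢ Set.univ.pi fun _ => s) := by
    apply Set.Subset.antisymm
    · rw [convexHull_eq_union]
      simp only [Set.iUnion_subset_iff]
      intro t hts hind x hx
      have hne : t.Nonempty := by
        rw [Finset.nonempty_iff_ne_empty]; rintro rfl; simp at hx
      have hcard : t.card ≤ D := by
        have h := hind.card_le_finrank_succ
        rw [Fintype.card_coe] at h
        exact h.trans (Nat.succ_le_succ (Submodule.finrank_le _))
      -- the points of `t`, repeated so as to number exactly `D`
      have hnt : Nonempty t := hne.to_subtype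
      obtain ⟨z, hz⟩ : ∃ z : Fin D → t, Function.Surjective z := by
        have hemb : Nonempty (t ↪ Fin D) := Function.Embedding.nonempty_of_card_le (by simpa)
        obtain ⟨g⟩ := hemb
        exact ⟨Function.invFun g, Function.invFun_surjective g.injective⟩
      have hrange : (t : Set E) =
          Fintype.linearCombination ℝ (fun i => (z i : E)) ''
            Set.range fun i : Fin D => Pi.single i (1 : ℝ) := by
        ext y
        simp only [Set.mem_image, Set.mem_range, exists_exists_eq_and,
          Fintype.linearCombination_apply_single, one_smul]
        constructor
        · intro hy
          obtain ⟨i, hi⟩ := hz ⟨y, hy⟩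
          exact ⟨i, by rw [hi]⟩
        · rintro ⟨i, rfl⟩
          exact (z i).2
      rw [hrange, ← LinearMap.image_convexHull, convexHull_rangle_single_eq_stdSimplex] at hx
      obtain ⟨w, hw, rfl⟩ := hx
      exact ⟨(w, fun i => z i), ⟨hw, fun i _ => hts (z i).2⟩, rfl⟩
    · rintro _ ⟨⟨w, z⟩, ⟨hw, hz⟩, rfl⟩
      exact (convex_convexHull ℝ s).sum_mem (fun i _ => hw.1 i) hw.2
        fun i _ => subset_convexHull ℝ s (hz i (Set.mem_univ i))
  rw [himg]
  exact ((isCompact_stdSimplex ℝ (Fin D)).prod (isCompact_univ_pi fun _ => hs)).image hF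

/-! ### The truncated moment problem on the half-line -/

/-- The moment curve of degree `n` in homogeneous form; for `s < 1` it is `(1 - s)ⁿ` times the
vector of powers of `s / (1 - s)`, and `s = 1` is the point at infinity of the half-line. -/
def momentCurve (n : ℕ) (s : ℝ) : Fin (n + 1) → ℝ :=
  fun k => s ^ (k : ℕ) * (1 - s) ^ (n - k)

/-- The Riesz functional `Xᵏ ↦ m_k` of a truncated sequence; powers above `n` are sent to `0`. -/
noncomputable def rieszFunctional {n : ℕ} (m : Fin (n + 1) → ℝ) : ℝ[X] →ₗ[ℝ] ℝ :=
  ∑ k : Fin (n + 1), m k • lcoeff ℝ (k : ℕ)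

lemma rieszFunctional_apply {n : ℕ} (m : Fin (n + 1) → ℝ) (p : ℝ[X]) :
    rieszFunctional m p = ∑ k : Fin (n + 1), m k * p.coeff k := by
  simp [rieszFunctional]

lemma rieszFunctional_X_pow {n : ℕ} (m : Fin (n + 1) → ℝ) (k : Fin (n + 1)) :
    rieszFunctional m (X ^ (k : ℕ)) = m k := by
  rw [rieszFunctional_apply, Finset.sum_eq_single k]
  · simp
  · intro b _ hb
    rw [coeff_X_pow, if_neg (fun h => hb (Fin.ext h)), mul_zero]
  · simp

/-- The Riesz functional is nonnegative on `Xˡ f²` when the `l`-shifted Hankel matrix is positive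
semidefinite. -/
lemma rieszFunctional_X_pow_mul_sq_nonneg {n l r : ℕ} (m : Fin (n + 1) → ℝ)
    (hb : ∀ i j : Fin r, (i : ℕ) + j + l < n + 1)
    (hM : (Matrix.of fun i j : Fin r => m ⟨i + j + l, hb i j⟩).PosSemidef) {f : ℝ[X]}
    (hf : f.natDegree < r) : 0 ≤ rieszFunctional m (X ^ l * (f * f)) := by
  have hsum : f = ∑ i : Fin r, f.coeff i • (X ^ (i : ℕ) : ℝ[X]) := by
    conv_lhs => rw [f.as_sum_range' r hf]
    rw [← Fin.sum_univ_eq_sum_range (fun i => (monomial i) (f.coeff i))]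
    simp [smul_X_eq_monomial]
  have hL : rieszFunctional m (X ^ l * (f * f)) =
      ∑ i : Fin r, ∑ j : Fin r, f.coeff i * (m ⟨i + j + l, hb i j⟩ * f.coeff j) := by
    have hexp : X ^ l * (f * f) =
        ∑ i : Fin r, ∑ j : Fin r, (f.coeff i * f.coeff j) • (X ^ ((i : ℕ) + j + l) : ℝ[X]) := by
      conv_lhs => rw [hsum]
      rw [Finset.sum_mul_sum, Finset.mul_sum]
      refine Finset.sum_congr rfl fun i _ => ?_
      rw [Finset.mul_sum]
      refine Finset.sum_congr rfl fun j _ => ?_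
      rw [smul_mul_smul_comm, mul_smul_comm]
      congr 1
      ring
    rw [hexp]
    simp only [map_sum, map_smul, smul_eq_mul]
    refine Finset.sum_congr rfl fun i _ => Finset.sum_congr rfl fun j _ => ?_
    rw [rieszFunctional_X_pow m ⟨i + j + l, hb i j⟩]
    ring
  have h := hM.dotProduct_mulVec_nonneg fun i : Fin r => f.coeff i
  simp only [dotProduct, Matrix.mulVec, Finset.mul_sum] at h
  rw [hL]
  simpa using h

/-- Solution of the truncated moment problem on `[0, ∞]`: if the Riesz functional of `m` is
nonnegative on the cone of `f²` and `X g²`, then `m` is a nonnegative multiple of a point in the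
convex hull of the moment curve. -/
theorem exists_smul_mem_convexHull_momentCurve {n : ℕ} (m : Fin (n + 1) → ℝ)
    (hm : ∀ p ∈ halfLineCone n, 0 ≤ rieszFunctional m p) :
    ∃ c : ℝ, 0 ≤ c ∧ ∃ x ∈ convexHull ℝ (momentCurve n '' Set.Icc 0 1), m = c • x := by
  set K := convexHull ℝ (momentCurve n '' Set.Icc 0 1) with hK
  have hcurve : ∀ s ∈ Set.Icc (0 : ℝ) 1, momentCurve n s ∈ K := fun s hs =>
    subset_convexHull ℝ _ ⟨s, hs, rfl⟩
  have hKclosed : IsClosed K := by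
    refine (IsCompact.convexHull_of_finiteDimensional (isCompact_Icc.image ?_)).isClosed
    unfold momentCurve
    fun_prop
  -- By the binomial theorem the functional `y ↦ ∑ y_k (n choose k)` is `1` on the moment curve;
  -- its value `φ` at `m` is the multiple sought.
  have hφ : rieszFunctional m ((X + 1) ^ n) = ∑ k : Fin (n + 1), m k * (n.choose k : ℝ) := by
    rw [rieszFunctional_apply]
    simp [coeff_X_add_one_pow]
  have hcone : (X + 1 : ℝ[X]) ^ n ∈ halfLineCone n :=
    pow_mem_halfLineCone (add_mem X_mem_halfLineCone
      (by simpa using C_mem_halfLineCone (m := 1) (zero_le_one' ℝ))) n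
  have hφ0 := hm _ hcone
  set φ := rieszFunctional m ((X + 1) ^ n) with hφdef
  have hm0 : ∀ k : Fin (n + 1), 0 ≤ m k := fun k => by
    rw [← rieszFunctional_X_pow m k]
    exact hm _ (halfLineCone_mono (by omega) (pow_mem_halfLineCone X_mem_halfLineCone k))
  rcases hφ0.eq_or_lt with hzero | hpos
  · refine ⟨0, le_rfl, _, hcurve 0 (by simp), ?_⟩
    rw [zero_smul]
    funext k
    have h1 : ∀ k ∈ Finset.univ, 0 ≤ m k * (n.choose (k : Fin (n + 1)) : ℝ) :=
      fun k _ => mul_nonneg (hm0 k) (Nat.cast_nonneg _)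
    have h2 := (Finset.sum_eq_zero_iff_of_nonneg h1).1 (hφ ▸ hzero.symm) k (Finset.mem_univ k)
    have h3 : (n.choose k : ℝ) ≠ 0 :=
      Nat.cast_ne_zero.2 (Nat.choose_pos (by omega)).ne'
    simpa [h3] using h2
  refine ⟨φ, hφ0, φ⁻¹ • m, ?_, by rw [smul_inv_smul₀ hpos.ne']⟩
  by_contra hx
  obtain ⟨f, u, hfx, hfK⟩ := geometric_hahn_banach_point_closed (convex_convexHull ℝ _) hKclosed hx
  have hfsum : ∀ y : Fin (n + 1) → ℝ, f y = ∑ k, y k * f (Pi.single k 1) := fun y => by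
    conv_lhs => rw [pi_eq_sum_univ' y]
    simp
  -- the separating functional `y ↦ f y - u ∑ y_k (n choose k)`, read as a polynomial nonnegative on the half-line
  set p : ℝ[X] := (∑ k : Fin (n + 1), f (Pi.single k 1) • (X ^ (k : ℕ) : ℝ[X])) -
    u • (X + 1) ^ n with hp
  have hLp : rieszFunctional m p = f m - u * φ := by
    rw [hp, map_sub, map_smul, map_sum, hfsum m]
    simp only [map_smul, rieszFunctional_X_pow, smul_eq_mul, ← hφdef]
    simp only [mul_comm]
  have hdeg : p.natDegree ≤ n := by
    refine (natDegree_sub_le _ _).trans (max_le (natDegree_sum_le_of_forall_le _ _ ?_) ?_)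
    · intro k _
      exact (natDegree_smul_le _ _).trans (by simp; omega)
    · refine (natDegree_smul_le _ _).trans ((natDegree_pow_le).trans ?_)
      rw [show (X + 1 : ℝ[X]) = X + C 1 by simp, natDegree_X_add_C, mul_one]
  have hpnn : ∀ t : ℝ, 0 ≤ t → 0 ≤ p.eval t := by
    intro t ht
    have h1t : 0 < 1 + t := by linarith
    have hmem := hfK _ (hcurve (t / (1 + t))
      ⟨by positivity, by rw [div_le_one h1t]; linarith⟩)
    have heval : p.eval t = (1 + t) ^ n * (f (momentCurve n (t / (1 + t))) - u) := by
      rw [hfsum, hp]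
      simp only [eval_sub, eval_finsetSum, eval_smul, eval_pow, eval_X, eval_add, eval_one,
        smul_eq_mul, mul_sub, Finset.mul_sum]
      congr 1
      · refine Finset.sum_congr rfl fun k _ => ?_
        have h2 : 1 - t / (1 + t) = 1 / (1 + t) := by field_simp; ring
        have h3 : (1 + t) ^ n = (1 + t) ^ (k : ℕ) * (1 + t) ^ (n - k) := by
          rw [← pow_add]; congr 1; omega
        rw [momentCurve, h2, h3, div_pow, div_pow, one_pow]
        field_simp
      · ring
    rw [heval]
    exact mul_nonneg (by positivity) (by linarith)
  have hfin := hm p (mem_halfLineCone_of_nonneg n p hdeg hpnn)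
  rw [hLp] at hfin
  rw [map_smul, smul_eq_mul, inv_mul_lt_iff₀ hpos] at hfx
  linarith

end MomentProblem

/-! ### The cone of separable operators -/

section Separable

variable {N d : ℕ}

lemma isSeparable_zero : IsSeparable (0 : Op N d) :=
  ⟨0, Fin.elim0, Fin.elim0, fun j => j.elim0, fun j => j.elim0, by simp⟩

lemma IsSeparable.add {σ τ : Op N d} (hσ : IsSeparable σ) (hτ : IsSeparable τ) :
    IsSeparable (σ + τ) := by
  obtain ⟨K, q, e, hq, he, rfl⟩ := hσ
  obtain ⟨K', q', e', hq', he', rfl⟩ := hτ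
  refine ⟨K + K', Fin.append q q', Fin.append e e', ?_, ?_, ?_⟩
  · exact fun j => Fin.addCases (by simpa using hq) (by simpa using hq') j
  · exact fun j => Fin.addCases (by simpa using he) (by simpa using he') j
  · simp [Fin.sum_univ_add]

lemma IsSeparable.smul {σ : Op N d} (hσ : IsSeparable σ) {c : ℝ} (hc : 0 ≤ c) :
    IsSeparable ((c : ℂ) • σ) := by
  obtain ⟨K, q, e, hq, he, rfl⟩ := hσ
  refine ⟨K, fun j => c * q j, e, fun j => mul_nonneg hc (hq j), he, ?_⟩
  simp only [Finset.smul_sum, smul_smul, Complex.ofReal_mul]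

lemma isSeparable_sum {ι : Type*} (t : Finset ι) {σ : ι → Op N d}
    (h : ∀ i ∈ t, IsSeparable (σ i)) : IsSeparable (∑ i ∈ t, σ i) :=
  Finset.sum_induction _ _ (fun _ _ => IsSeparable.add) isSeparable_zero h

/-- The projector onto an unnormalized product vector is separable. -/
lemma isSeparable_ketbra_productVec (e : Fin N → Fin d → ℂ) :
    IsSeparable (ketbra (productVec e)) := by
  set r : Fin N → ℝ := fun i => √(∑ a, ‖e i a‖ ^ 2) with hr
  have hr2 : ∀ i, r i ^ 2 = ∑ a, ‖e i a‖ ^ 2 := fun i =>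
    Real.sq_sqrt (Finset.sum_nonneg fun a _ => sq_nonneg _)
  by_cases h0 : ∃ i, r i = 0
  · obtain ⟨i, hi⟩ := h0
    have hei : ∀ a, e i a = 0 := fun a => by
      have h1 := hr2 i
      rw [hi, zero_pow two_ne_zero, eq_comm,
        Finset.sum_eq_zero_iff_of_nonneg (fun a _ => sq_nonneg _)] at h1
      simpa using h1 a (Finset.mem_univ a)
    have hz : productVec e = 0 := by
      funext w
      exact Finset.prod_eq_zero (Finset.mem_univ i) (hei (w i))
    rw [hz]
    convert isSeparable_zero (N := N) (d := d)
    ext w w'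
    simp [ketbra, Matrix.vecMulVec]
  · push Not at h0
    refine ⟨1, fun _ => ∏ i, r i ^ 2, fun _ i a => ((r i)⁻¹ : ℝ) * e i a,
      fun _ => Finset.prod_nonneg fun i _ => sq_nonneg _, fun _ i => ?_, ?_⟩
    · simp only [norm_mul, mul_pow, ← Finset.mul_sum, Complex.norm_real, ← hr2]
      rw [norm_inv, Real.norm_eq_abs, inv_pow, sq_abs]
      exact inv_mul_cancel₀ (pow_ne_zero 2 (h0 i))
    · ext w w'
      simp only [ketbra, productVec, Matrix.vecMulVec_apply, Pi.star_apply, Finset.univ_unique,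
        Finset.sum_singleton, Matrix.smul_apply, smul_eq_mul, RCLike.star_def, map_prod, map_mul,
        Complex.conj_ofReal, Complex.ofReal_prod, ← Finset.prod_mul_distrib]
      refine Finset.prod_congr rfl fun i _ => ?_
      have := Complex.ofReal_ne_zero.2 (h0 i)
      push_cast
      field_simp

end Separable

/-! ### Dicke vectors in the computational basis -/

section Dicke

variable {N d : ℕ}

/-- The sum of the letters of a word. -/
def letterSum (w : Word N d) : ℕ := ∑ i, (w i : ℕ)

lemma letterSum_le (w : Word N d) : letterSum w ≤ N * (d - 1) := by
  have h := Finset.sum_le_card_nsmul Finset.univ (fun i => (w i : ℕ)) (d - 1)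
    fun i _ => Nat.le_sub_one_of_lt (w i).isLt
  simpa [letterSum] using h

/-- The sum of the letters of a word, as the index of a Dicke vector. -/
def letterSumFin (w : Word N d) : Fin (N * (d - 1) + 1) :=
  ⟨letterSum w, Nat.lt_succ_of_le (letterSum_le w)⟩

lemma exists_letterSum_eq (hd : 2 ≤ d) {k : ℕ} (hk : k ≤ N * (d - 1)) :
    ∃ w : Word N d, letterSum w = k := by
  -- fill the letters greedily from the left
  refine ⟨fun i => ⟨min (d - 1) (k - i * (d - 1)), by omega⟩, ?_⟩
  have h : ∀ M : ℕ, ∑ i ∈ Finset.range M, min (d - 1) (k - i * (d - 1)) = min (M * (d - 1)) k := by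
    intro M
    induction M with
    | zero => simp
    | succ M ih =>
      rw [Finset.sum_range_succ, ih, Nat.succ_mul]
      omega
  rw [letterSum, Fin.sum_univ_eq_sum_range (fun i => min (d - 1) (k - i * (d - 1))), h,
    min_eq_right hk]

lemma occupation_mem_piAntidiag (w : Word N d) :
    occupation w ∈ Finset.piAntidiag (Finset.univ : Finset (Fin d)) N := by
  rw [Finset.mem_piAntidiag]
  refine ⟨?_, fun _ _ => Finset.mem_univ _⟩
  have := Finset.card_eq_sum_card_fiberwise (f := w) (s := Finset.univ) (t := Finset.univ)
    (fun _ _ => Finset.mem_univ _)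
  rw [Finset.card_univ, Fintype.card_fin] at this
  exact this.symm

lemma sum_mul_occupation (w : Word N d) :
    ∑ a : Fin d, (a : ℕ) * occupation w a = letterSum w := by
  rw [letterSum, ← Finset.sum_fiberwise Finset.univ w]
  refine Finset.sum_congr rfl fun a _ => ?_
  rw [Finset.sum_congr rfl (g := fun _ => (a : ℕ))]
  · simp [occupation, mul_comm]
  · intro i hi
    rw [(Finset.mem_filter.1 hi).2]

/-- The factors `(N choose κ)^{1/2}` cancel: the unnormalized Dicke vector is the sum of all basis
vectors whose letters add up to `k`. -/
lemma dickeSum_apply (k : ℕ) (w : Word N d) :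
    dickeSum N d k w = if letterSum w = k then 1 else 0 := by
  rw [dickeSum, Finset.sum_apply]
  simp only [Pi.smul_apply, symVec, smul_eq_mul, mul_ite, mul_zero, Finset.sum_ite_eq,
    Finset.mem_filter, occupation_mem_piAntidiag, sum_mul_occupation, true_and]
  have h : (0 : ℝ) < √(Nat.multinomial Finset.univ (occupation w)) :=
    Real.sqrt_pos.2 (Nat.cast_pos.2 (Nat.multinomial_pos _ _))
  rw [← Complex.ofReal_mul, mul_inv_cancel₀ h.ne', Complex.ofReal_one]

lemma dickeNorm_nonneg (N d k : ℕ) : 0 ≤ dickeNorm N d k :=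
  Finset.sum_nonneg fun _ _ => sq_nonneg _

lemma dickeNorm_pos (hd : 2 ≤ d) {k : ℕ} (hk : k ≤ N * (d - 1)) : 0 < dickeNorm N d k := by
  obtain ⟨w, hw⟩ := exists_letterSum_eq hd hk
  refine Finset.sum_pos' (fun _ _ => sq_nonneg _) ⟨w, Finset.mem_univ w, ?_⟩
  simp [dickeSum_apply, hw]

lemma ketbra_dicke_apply (k : ℕ) (w w' : Word N d) :
    ketbra (dicke N d k) w w' =
      if letterSum w = k ∧ letterSum w' = k then (((dickeNorm N d k)⁻¹ : ℝ) : ℂ) else 0 := by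
  have h : ((√(dickeNorm N d k))⁻¹ : ℝ) * (√(dickeNorm N d k))⁻¹ = (dickeNorm N d k)⁻¹ := by
    rw [← mul_inv, Real.mul_self_sqrt (dickeNorm_nonneg N d k)]
  simp only [ketbra, Matrix.vecMulVec_apply, dicke, Pi.smul_apply, Pi.star_apply, dickeSum_apply,
    smul_eq_mul, star_mul', RCLike.star_def, Complex.conj_ofReal]
  rw [← h]
  by_cases h1 : letterSum w = k <;> by_cases h2 : letterSum w' = k <;> simp [h1, h2]

lemma trace_ketbra_dicke (hd : 2 ≤ d) {k : ℕ} (hk : k ≤ N * (d - 1)) :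
    (ketbra (dicke N d k)).trace = 1 := by
  have hpos := dickeNorm_pos hd hk
  have h : (ketbra (dicke N d k)).trace =
      (((dickeNorm N d k)⁻¹ * ∑ w : Word N d, ‖dickeSum N d k w‖ ^ 2 : ℝ) : ℂ) := by
    rw [Matrix.trace, Finset.mul_sum, Complex.ofReal_sum]
    refine Finset.sum_congr rfl fun w _ => ?_
    rw [Matrix.diag_apply, ketbra_dicke_apply, dickeSum_apply]
    by_cases h1 : letterSum w = k <;> simp [h1]
  rw [h, ← dickeNorm, inv_mul_cancel₀ hpos.ne', Complex.ofReal_one]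

lemma trace_dickeDiag (hd : 2 ≤ d) (p : Fin (N * (d - 1) + 1) → ℝ) :
    (dickeDiag N d p).trace = ((∑ k, p k : ℝ) : ℂ) := by
  rw [dickeDiag, Matrix.trace_sum, Complex.ofReal_sum]
  refine Finset.sum_congr rfl fun k _ => ?_
  rw [Matrix.trace_smul, trace_ketbra_dicke hd (Nat.le_of_lt_succ k.isLt), smul_eq_mul, mul_one]

lemma dickeProj_eq_dickeDiag (N d : ℕ) : dickeProj N d = dickeDiag N d fun _ => 1 := by
  simp [dickeProj, dickeDiag]

lemma dickeDiag_add (p q : Fin (N * (d - 1) + 1) → ℝ) :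
    dickeDiag N d p + dickeDiag N d q = dickeDiag N d fun k => p k + q k := by
  simp [dickeDiag, ← Finset.sum_add_distrib, add_smul]

lemma smul_dickeDiag (c : ℝ) (p : Fin (N * (d - 1) + 1) → ℝ) :
    (c : ℂ) • dickeDiag N d p = dickeDiag N d fun k => c * p k := by
  simp only [dickeDiag, Finset.smul_sum, smul_smul, Complex.ofReal_mul]

lemma trace_dickeProj (hd : 2 ≤ d) :
    (dickeProj N d).trace = ((N * (d - 1) + 1 : ℕ) : ℂ) := by
  rw [dickeProj_eq_dickeDiag, trace_dickeDiag hd]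
  simp

/-- The operator whose entry at a pair of words with the same letter sum `k` is `m_k`, and whose
other entries vanish. -/
noncomputable def momentOp (m : Fin (N * (d - 1) + 1) → ℝ) : Op N d := Matrix.of fun w w' =>
  if letterSum w = letterSum w' then (m (letterSumFin w) : ℂ) else 0

lemma dickeDiag_eq_momentOp (p : Fin (N * (d - 1) + 1) → ℝ) :
    dickeDiag N d p = momentOp fun k => p k / dickeNorm N d k := by
  ext w w'
  rw [dickeDiag, Matrix.sum_apply, Finset.sum_eq_single (letterSumFin w)]
  · rw [Matrix.smul_apply, ketbra_dicke_apply]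
    by_cases h : letterSum w = letterSum w'
    · simp [momentOp, letterSumFin, h, div_eq_mul_inv]
    · simp [momentOp, letterSumFin, h, Ne.symm h]
  · intro k _ hk
    rw [Matrix.smul_apply, ketbra_dicke_apply, if_neg, smul_zero]
    rintro ⟨h, -⟩
    exact hk (Fin.ext h.symm)
  · simp

/-- A positive semidefinite Dicke-diagonal operator has nonnegative coefficients. -/
lemma nonneg_of_posSemidef_dickeDiag (hd : 2 ≤ d) {p : Fin (N * (d - 1) + 1) → ℝ}
    (h : (dickeDiag N d p).PosSemidef) (k : Fin (N * (d - 1) + 1)) : 0 ≤ p k := by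
  have hk := Nat.le_of_lt_succ k.isLt
  obtain ⟨w, hw⟩ := exists_letterSum_eq hd hk
  have hwk : letterSumFin w = k := Fin.ext hw
  have h1 := h.diag_nonneg (i := w)
  rw [dickeDiag_eq_momentOp] at h1
  simp only [momentOp, Matrix.of_apply, if_true, hwk, Complex.zero_le_real] at h1
  exact by simpa using (le_div_iff₀ (dickeNorm_pos hd hk)).1 h1

end Dicke

/-! ### Separability from the moment problem -/

section Moment

variable {N d : ℕ}

lemma sum_root_pow_mul_conj_pow {M : ℕ} {ζ : ℂ} (hζ : IsPrimitiveRoot ζ M) {a b : ℕ} (ha : a < M)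
    (hb : b < M) :
    ∑ j ∈ Finset.range M, (ζ ^ a * (starRingEnd ℂ) ζ ^ b) ^ j = if a = b then (M : ℂ) else 0 := by
  have hone : ζ * (starRingEnd ℂ) ζ = 1 := by
    rw [Complex.mul_conj', hζ.norm'_eq_one (by omega)]
    simp
  split_ifs with h
  · subst h
    simp [← mul_pow, hone]
  · have hne : ζ ^ a * (starRingEnd ℂ) ζ ^ b ≠ 1 := by
      intro h1
      refine h (hζ.pow_inj ha hb ?_)
      calc ζ ^ a = ζ ^ a * (ζ * (starRingEnd ℂ) ζ) ^ b := by rw [hone, one_pow, mul_one]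
        _ = (ζ ^ a * (starRingEnd ℂ) ζ ^ b) * ζ ^ b := by rw [mul_pow]; ring
        _ = ζ ^ b := by rw [h1, one_mul]
    have h2 := geom_sum_mul (ζ ^ a * (starRingEnd ℂ) ζ ^ b) M
    have hconj : (starRingEnd ℂ) ζ ^ M = 1 := by rw [← map_pow, hζ.pow_eq_one, map_one]
    have h3 : (ζ ^ a * (starRingEnd ℂ) ζ ^ b) ^ M = 1 := by
      rw [mul_pow, pow_right_comm, hζ.pow_eq_one, pow_right_comm, hconj, one_pow, one_pow, mul_one]
    rw [h3, sub_self] at h2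
    exact (mul_eq_zero.1 h2).resolve_right (sub_ne_zero.2 hne)

/-- The operator of a point of the moment curve is separable: it is the average over the `M`-th
roots of unity `ω`, with `M = N(d-1) + 1`, of the projectors onto the `N`-th tensor powers of the
vector with entries `x^a y^(d-1-a) ω^a`, where `x² = s` and `y² = 1 - s`. The average removes the
entries at pairs of words with different letter sums. -/
lemma isSeparable_momentOp_momentCurve {s : ℝ} (hs : s ∈ Set.Icc (0 : ℝ) 1) :
    IsSeparable (momentOp (N := N) (d := d) (momentCurve (N * (d - 1)) s)) := by
  set n := N * (d - 1) with hn
  obtain ⟨ζ, hζ⟩ : ∃ ζ : ℂ, IsPrimitiveRoot ζ (n + 1) :=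
    ⟨_, Complex.isPrimitiveRoot_exp (n + 1) (by omega)⟩
  set e : ℕ → Fin N → Fin d → ℂ := fun j _ a =>
    (√s : ℂ) ^ (a : ℕ) * (√(1 - s) : ℂ) ^ (d - 1 - (a : ℕ)) * (ζ ^ j) ^ (a : ℕ) with he
  have hprod : ∀ j (w : Word N d), productVec (e j) w =
      (√s : ℂ) ^ letterSum w * (√(1 - s) : ℂ) ^ (n - letterSum w) * (ζ ^ j) ^ letterSum w := by
    intro j w
    have hsub : ∑ i, (d - 1 - (w i : ℕ)) = n - letterSum w := by
      rw [Finset.sum_tsub_distrib _ fun i _ => Nat.le_sub_one_of_lt (w i).isLt]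
      simp [letterSum, hn]
    simp only [productVec, he, Finset.prod_mul_distrib, Finset.prod_pow_eq_pow_sum, hsub]
    rfl
  have hM : ((n + 1 : ℕ) : ℂ) ≠ 0 := Nat.cast_ne_zero.2 (by omega)
  have key : momentOp (N := N) (d := d) (momentCurve n s) =
      (((n + 1 : ℕ) : ℝ)⁻¹ : ℝ) • ∑ j ∈ Finset.range (n + 1), ketbra (productVec (e j)) := by
    ext w w'
    have hw := letterSum_le w
    have hw' := letterSum_le w'
    have hterm : ∀ j, ketbra (productVec (e j)) w w' =
        ((√s : ℂ) ^ letterSum w * (√(1 - s) : ℂ) ^ (n - letterSum w) *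
          ((√s : ℂ) ^ letterSum w' * (√(1 - s) : ℂ) ^ (n - letterSum w'))) *
          (ζ ^ letterSum w * (starRingEnd ℂ) ζ ^ letterSum w') ^ j := by
      intro j
      simp only [ketbra, Matrix.vecMulVec_apply, Pi.star_apply, hprod, RCLike.star_def, map_mul,
        map_pow, Complex.conj_ofReal]
      ring
    rw [Matrix.smul_apply, Matrix.sum_apply]
    simp only [hterm]
    rw [← Finset.mul_sum, sum_root_pow_mul_conj_pow hζ (by omega) (by omega)]
    by_cases h : letterSum w = letterSum w'
    · have h1 : (√s : ℂ) * √s = s := by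
        rw [← Complex.ofReal_mul, Real.mul_self_sqrt hs.1]
      have h2 : (√(1 - s) : ℂ) * √(1 - s) = 1 - s := by
        rw [← Complex.ofReal_mul, Real.mul_self_sqrt (by linarith [hs.2])]
        simp
      rw [if_pos h, ← h, mul_mul_mul_comm, ← mul_pow, ← mul_pow, h1, h2, Complex.real_smul]
      simp only [momentOp, Matrix.of_apply, if_pos h, momentCurve, letterSumFin]
      push_cast at hM ⊢
      field_simp
    · simp [momentOp, h]
  rw [key]
  exact (isSeparable_sum _ fun j _ => isSeparable_ketbra_productVec _).smul
    (inv_nonneg.2 (Nat.cast_nonneg _))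

lemma isSeparable_momentOp_of_mem_convexHull {x : Fin (N * (d - 1) + 1) → ℝ}
    (hx : x ∈ convexHull ℝ (momentCurve (N * (d - 1)) '' Set.Icc 0 1)) :
    IsSeparable (momentOp (N := N) (d := d) x) := by
  refine convexHull_min (t := {x | IsSeparable (momentOp (N := N) (d := d) x)}) ?_ ?_ hx
  · rintro _ ⟨s, hs, rfl⟩
    exact isSeparable_momentOp_momentCurve hs
  · intro x hx y hy a b ha hb _
    have hop : momentOp (N := N) (d := d) (a • x + b • y) =
        (a : ℂ) • momentOp x + (b : ℂ) • momentOp y := by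
      ext w w'
      by_cases h : letterSum w = letterSum w' <;> simp [momentOp, h]
    change IsSeparable (momentOp (a • x + b • y))
    rw [hop]
    exact (IsSeparable.smul hx ha).add (IsSeparable.smul hy hb)

/-- A Dicke-diagonal operator is separable if both of its Hankel matrices are positive
semidefinite. -/
theorem isSeparable_dickeDiag_of_hankel_posSemidef (hN : 1 ≤ N) (hd : 2 ≤ d)
    {q : Fin (N * (d - 1) + 1) → ℝ} (h0 : (hankel N d 0 q).PosSemidef)
    (h1 : (hankel N d 1 q).PosSemidef) : IsSeparable (dickeDiag N d q) := by
  rw [dickeDiag_eq_momentOp]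
  set m : Fin (N * (d - 1) + 1) → ℝ := fun k => q k / dickeNorm N d k with hm
  have hn : 1 ≤ N * (d - 1) := Nat.mul_pos hN (by omega)
  obtain ⟨c, hc, x, hx, hmx⟩ := exists_smul_mem_convexHull_momentCurve m fun p hp => by
    induction hp using AddSubmonoid.closure_induction with
    | zero => simp
    | add p q _ _ hp hq => rw [map_add]; exact add_nonneg hp hq
    | mem p hp =>
      rcases hp with ⟨f, hf, rfl⟩ | ⟨g, hg, rfl⟩
      · have h := rieszFunctional_X_pow_mul_sq_nonneg m (l := 0)
          (r := (N * (d - 1) + 2 - 0) / 2) (fun i j => by omega) h0 (f := f) (by omega)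
        simpa using h
      · have h := rieszFunctional_X_pow_mul_sq_nonneg m (l := 1)
          (r := (N * (d - 1) + 2 - 1) / 2) (fun i j => by omega) h1 (f := g) (by omega)
        simpa using h
  have hop : momentOp (N := N) (d := d) m = (c : ℂ) • momentOp x := by
    rw [hmx]
    ext w w'
    by_cases h : letterSum w = letterSum w' <;> simp [momentOp, h]
  rw [hop]
  exact (isSeparable_momentOp_of_mem_convexHull hx).smul hc

end Moment

/-! ### The reduction map -/

section Reduction

variable {N d : ℕ}

lemma reductionMap_dickeDiag (hd : 2 ≤ d) (α : ℝ) (p : Fin (N * (d - 1) + 1) → ℝ) :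
    reductionMap N d α (dickeDiag N d p) = dickeDiag N d fun k => ∑ j, p j + α * p k := by
  rw [reductionMap, trace_dickeDiag hd, dickeProj_eq_dickeDiag, smul_dickeDiag, smul_dickeDiag,
    dickeDiag_add]
  simp

lemma reductionMap_smul (α : ℝ) (c : ℂ) (ρ : Op N d) :
    reductionMap N d α (c • ρ) = c • reductionMap N d α ρ := by
  simp only [reductionMap, Matrix.trace_smul, smul_add, smul_smul, smul_eq_mul, mul_comm]

lemma isSeparable_reductionMap_dickeDiag (hN : 1 ≤ N) (hd : 2 ≤ d) {α : ℝ}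
    {p : Fin (N * (d - 1) + 1) → ℝ} (hp : p ∈ stdSimplex ℝ (Fin (N * (d - 1) + 1)))
    (h : HankelPSD N d α p) : IsSeparable (reductionMap N d α (dickeDiag N d p)) := by
  rw [reductionMap_dickeDiag hd, hp.2]
  exact isSeparable_dickeDiag_of_hankel_posSemidef hN hd h.1 h.2

lemma leftInverse_reductionInv (hd : 2 ≤ d) {α : ℝ} (hα : α ≠ 0)
    (hα' : ((N * (d - 1) + 1 : ℕ) : ℝ) + α ≠ 0) :
    Function.LeftInverse (reductionInv N d α) (reductionMap N d α) := by
  intro ρ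
  have h1 : (α : ℂ) ≠ 0 := Complex.ofReal_ne_zero.2 hα
  have h2 : ((N * (d - 1) + 1 : ℕ) : ℂ) + (α : ℂ) ≠ 0 := by exact_mod_cast hα'
  have ht : (reductionMap N d α ρ).trace = ρ.trace * (((N * (d - 1) + 1 : ℕ) : ℂ) + α) := by
    rw [reductionMap, Matrix.trace_add, Matrix.trace_smul, Matrix.trace_smul, trace_dickeProj hd,
      smul_eq_mul, smul_eq_mul]
    ring
  rw [reductionInv, ht, mul_div_cancel_right₀ _ h2, reductionMap, add_sub_cancel_left,
    inv_smul_smul₀ h1]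

lemma rightInverse_reductionInv (hd : 2 ≤ d) {α : ℝ} (hα : α ≠ 0)
    (hα' : ((N * (d - 1) + 1 : ℕ) : ℝ) + α ≠ 0) :
    Function.RightInverse (reductionInv N d α) (reductionMap N d α) := by
  intro σ
  have h1 : (α : ℂ) ≠ 0 := Complex.ofReal_ne_zero.2 hα
  have h2 : ((N * (d - 1) + 1 : ℕ) : ℂ) + (α : ℂ) ≠ 0 := by exact_mod_cast hα'
  have ht : (reductionInv N d α σ).trace = σ.trace / (((N * (d - 1) + 1 : ℕ) : ℂ) + α) := by
    rw [reductionInv, Matrix.trace_smul, Matrix.trace_sub, Matrix.trace_smul, trace_dickeProj hd,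
      smul_eq_mul, smul_eq_mul]
    generalize ((N * (d - 1) + 1 : ℕ) : ℂ) = D at h2
    field_simp
    ring
  rw [reductionMap, ht, reductionInv, smul_inv_smul₀ h1, add_sub_cancel]

lemma reductionInv_dickeDiag (hd : 2 ≤ d) (α : ℝ) (s : Fin (N * (d - 1) + 1) → ℝ) :
    reductionInv N d α (dickeDiag N d s) = dickeDiag N d fun k =>
      α⁻¹ * (s k - (∑ j, s j) / (((N * (d - 1) + 1 : ℕ) : ℝ) + α)) := by
  set c : ℝ := (∑ j, s j) / (((N * (d - 1) + 1 : ℕ) : ℝ) + α) with hc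
  have h : (dickeDiag N d s).trace / (((N * (d - 1) + 1 : ℕ) : ℂ) + α) = (c : ℂ) := by
    rw [trace_dickeDiag hd, hc]
    push_cast
    rfl
  rw [reductionInv, h, dickeProj_eq_dickeDiag, sub_eq_add_neg, ← neg_smul, ← Complex.ofReal_neg,
    smul_dickeDiag, dickeDiag_add, ← Complex.ofReal_inv, smul_dickeDiag]
  simp [sub_eq_add_neg]

/-- If the preimage of `σ` under the reduction map is a nonnegative multiple of a Dicke-diagonal
state for which the Hankel matrices are positive semidefinite, then `σ` is separable. -/
lemma isSeparable_of_reductionInv_eq_smul (hN : 1 ≤ N) (hd : 2 ≤ d) {α : ℝ} (hα : α ≠ 0)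
    (hα' : ((N * (d - 1) + 1 : ℕ) : ℝ) + α ≠ 0) {σ : Op N d} {c : ℝ} (hc : 0 ≤ c)
    {p : Fin (N * (d - 1) + 1) → ℝ} (hp : p ∈ stdSimplex ℝ (Fin (N * (d - 1) + 1)))
    (h : reductionInv N d α σ = (c : ℂ) • dickeDiag N d p) (hH : HankelPSD N d α p) :
    IsSeparable σ := by
  rw [← rightInverse_reductionInv hd hα hα' σ, h, reductionMap_smul]
  exact (isSeparable_reductionMap_dickeDiag hN hd hp hH).smul hc

end Reduction

end QuditDicke

theorem mainTheorem6 (N d : ℕ) (hN : 1 ≤ N) (hd : 2 ≤ d) (α : ℝ) :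
    (∀ p ∈ stdSimplex ℝ (Fin (N * (d - 1) + 1)), QuditDicke.HankelPSD N d α p →
        QuditDicke.IsSeparable
          (QuditDicke.reductionMap N d α (QuditDicke.dickeDiag N d p))) ∧
    (α ≠ 0 → ((N * (d - 1) + 1 : ℕ) : ℝ) + α ≠ 0 →
      Function.LeftInverse (QuditDicke.reductionInv N d α) (QuditDicke.reductionMap N d α) ∧
      Function.RightInverse (QuditDicke.reductionInv N d α) (QuditDicke.reductionMap N d α) ∧
      (∀ s : Fin (N * (d - 1) + 1) → ℝ, ∀ p ∈ stdSimplex ℝ (Fin (N * (d - 1) + 1)),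
        (QuditDicke.dickeDiag N d s).PosSemidef →
        (QuditDicke.reductionInv N d α (QuditDicke.dickeDiag N d s)).PosSemidef →
        QuditDicke.reductionInv N d α (QuditDicke.dickeDiag N d s) =
          (QuditDicke.reductionInv N d α (QuditDicke.dickeDiag N d s)).trace •
            QuditDicke.dickeDiag N d p →
        QuditDicke.HankelPSD N d α p →
        QuditDicke.IsSeparable (QuditDicke.dickeDiag N d s)) ∧
      ((∀ p ∈ stdSimplex ℝ (Fin (N * (d - 1) + 1)), QuditDicke.HankelPSD N d α p) →
        ∀ s : Fin (N * (d - 1) + 1) → ℝ,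
          (QuditDicke.dickeDiag N d s).PosSemidef →
          (QuditDicke.reductionInv N d α (QuditDicke.dickeDiag N d s)).PosSemidef →
          QuditDicke.IsSeparable (QuditDicke.dickeDiag N d s))) := by
  open QuditDicke in
  refine ⟨fun p hp h => isSeparable_reductionMap_dickeDiag hN hd hp h, fun hα hα' =>
    ⟨leftInverse_reductionInv hd hα hα', rightInverse_reductionInv hd hα hα', ?_, ?_⟩⟩
  · intro s p hp _ hρ h hH
    have hc : ((reductionInv N d α (dickeDiag N d s)).trace.re : ℂ) =
        (reductionInv N d α (dickeDiag N d s)).trace :=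
      Complex.ext rfl (Complex.nonneg_iff.1 hρ.trace_nonneg).2
    rw [← hc] at h
    exact isSeparable_of_reductionInv_eq_smul hN hd hα hα'
      (Complex.nonneg_iff.1 hρ.trace_nonneg).1 hp h hH
  · intro hH s _ hρ
    obtain ⟨r, hr⟩ : ∃ r, reductionInv N d α (dickeDiag N d s) = dickeDiag N d r :=
      ⟨_, reductionInv_dickeDiag hd α s⟩
    have hr0 := nonneg_of_posSemidef_dickeDiag hd (hr ▸ hρ)
    have hsum : 0 ≤ ∑ k, r k := Finset.sum_nonneg fun k _ => hr0 k
    -- for `r = 0` any point of the simplex will do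
    obtain ⟨p, hp, hrp⟩ : ∃ p ∈ stdSimplex ℝ (Fin (N * (d - 1) + 1)),
        ∀ k, r k = (∑ j, r j) * p k := by
      rcases hsum.eq_or_lt with h0 | hpos
      · refine ⟨_, single_mem_stdSimplex ℝ 0, fun k => ?_⟩
        rw [← h0, zero_mul]
        exact (Finset.sum_eq_zero_iff_of_nonneg fun k _ => hr0 k).1 h0.symm k (Finset.mem_univ k)
      · refine ⟨fun k => r k / ∑ j, r j, ⟨fun k => div_nonneg (hr0 k) hsum, ?_⟩, fun k => ?_⟩
        · rw [← Finset.sum_div, div_self hpos.ne']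
        · field_simp
    refine isSeparable_of_reductionInv_eq_smul hN hd hα hα' hsum hp ?_ (hH p hp)
    rw [hr, smul_dickeDiag]
    exact congrArg _ (funext hrp)
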